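/- Let $\Gamma=(V,E)$ be a finite, connected, simple graph with at least one edge, $N=\#E$. Identify each edge $e$ with the interval $[0,1]$, i.e. choose an arbitrary orientation of each edge, and for $v\in V$, $e\in E$ put $d_{ve}=1$ if $v$ is the end of $e$ at the parameter $1$, $d_{ve}=-1$ if $v$ is the end of $e$ at the parameter $0$, and $d_{ve}=0$ otherwise. For $u=(u_e)_{e\in E}\in C^2([0,1];\mathbb C)^N$ and $v\in e$, write $u_e(v)$ and $u_e'(v)$ for the values of $u_e$ and $u_e'$ at the end $v$ of $e$. Consider the operator $\Delta:(u_e)\mapsto(u_e'')$ as an unbounded operator on $C([0,1];\mathbb C)^N$. Let $\Delta^{CK}$ be its restriction to those $u\in C^2([0,1];\mathbb C)^N$ such that $u_e(v)=u_{e'}(v)$ whenever $v$ is a common end of $e$ and $e'$, and $\sum_{e} d_{ve}\,u_e'(v)=0$ for all $v\in V$; let $\Delta^{KC}$ be its restriction to those $u\in C^2([0,1];\mathbb C)^N$ such that $\sum_{e} d_{ve}^2\,u_e(v)=0$ for all $v\in V$, and $d_{ve}\,u_e'(v)=d_{ve'}\,u_{e'}'(v)$ whenever $v$ is a common end of $e$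 and $e'$. Then the spectra of $-\Delta^{CK}$ and $-\Delta^{KC}$ coincide, counting (geometric) multiplicities of eigenvalues, if and only if $\Gamma$ is bipartite and unicyclic, i.e. contains exactly one circuit (a circuit being a connected subgraph that is regular of degree $2$). -/

import Mathlib

/-- The (metric) realization of a graph: every edge is identified with `[0,1]`. `tail e` is the
vertex at the parameter `0` of the edge `e`, and `head e` is the vertex at the parameter `1`. -/
structure EdgeParam {V : Type*} (G : SimpleGraph V) where
  tail : G.edgeSet → V
  head : G.edgeSet → V
  endpoints : ∀ e : G.edgeSet, (e : Sym2 V) = s(tail e, head e)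

/-- `G` is unicyclic: it contains exactly one circuit, a circuit being a connected
graph that is regular of degree two. -/
def IsUnicyclic {V : Type*} (G : SimpleGraph V) : Prop :=
  ∃! H : G.Subgraph, H.Connected ∧ ∀ v ∈ H.verts, (H.neighborSet v).ncard = 2

namespace UnboundedOp

variable {X : Type*} [AddCommGroup X] [Module ℂ X] [TopologicalSpace X]

/-- The resolvent set of an unbounded operator `A` on `X`: the complex numbers `z` such that
`A - z : D(A) → X` is a bijection with bounded inverse `R`. -/
def resolventSet (A : X →ₗ.[ℂ] X) : Set ℂ :=
  {z | ∃ R : X →L[ℂ] X,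
    (∀ f : X, ∃ h : R f ∈ A.domain, A ⟨R f, h⟩ - z • R f = f) ∧
    ∀ u : A.domain, R (A u - z • (u : X)) = u}

/-- The spectrum of an unbounded operator. -/
def spectrum (A : X →ₗ.[ℂ] X) : Set ℂ := (resolventSet A)ᶜ

/-- The eigenspace `ker (A - z)` of an unbounded operator. -/
def eigenspace (A : X →ₗ.[ℂ] X) (z : ℂ) : Submodule ℂ X :=
  (LinearMap.ker (A.toFun - z • A.domain.subtype)).map A.domain.subtype

/-- The spectra of `A` and `B` coincide, counting multiplicities. -/
def SameSpectrum (A B : X →ₗ.[ℂ] X) : Prop :=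
  spectrum A = spectrum B ∧
    ∀ z : ℂ, Module.rank ℂ (eigenspace A z) = Module.rank ℂ (eigenspace B z)

end UnboundedOp

noncomputable section

namespace QGraph

open Set

/-- The continuous functions `u = (u_e) : [0,1] → ℂ^N`, one component for each of the `N` edges. -/
abbrev NetFun {V : Type*} (G : SimpleGraph V) : Type _ := C(unitInterval, G.edgeSet → ℂ)

variable {V : Type*} {G : SimpleGraph V}

/-- The component `u_e`, as a function of a real variable (constant outside `[0,1]`; only its
values on `[0,1]` matter below). -/
def comp (u : NetFun G) (e : G.edgeSet) : ℝ → ℂ := fun x => u (projIcc 0 1 zero_le_one x) e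

/-- The derivative of `u_e` on `[0,1]` (one-sided at `0` and at `1`). -/
def edgeDeriv (u : NetFun G) (e : G.edgeSet) (x : ℝ) : ℂ :=
  derivWithin (comp u e) (Icc 0 1) x

/-- The second derivative of `u_e` on `[0,1]`. -/
def edgeDeriv₂ (u : NetFun G) (e : G.edgeSet) (x : ℝ) : ℂ :=
  derivWithin (edgeDeriv u e) (Icc 0 1) x

/-- All components of `u` are in `C²[0,1]`. -/
def IsC2 (u : NetFun G) : Prop := ∀ e, ContDiffOn ℝ 2 (comp u e) (Icc 0 1)

lemma IsC2.hasDeriv {u : NetFun G} (hu : IsC2 u) (e : G.edgeSet) {x : ℝ}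
    (hx : x ∈ Icc (0 : ℝ) 1) :
    HasDerivWithinAt (comp u e) (edgeDeriv u e x) (Icc 0 1) x :=
  (((hu e).differentiableOn (by norm_num)) x hx).hasDerivWithinAt

lemma IsC2.contDiffOn_deriv {u : NetFun G} (hu : IsC2 u) (e : G.edgeSet) :
    ContDiffOn ℝ 1 (edgeDeriv u e) (Icc 0 1) :=
  (hu e).derivWithin (uniqueDiffOn_Icc zero_lt_one) (by norm_num)

lemma IsC2.hasDeriv₂ {u : NetFun G} (hu : IsC2 u) (e : G.edgeSet) {x : ℝ}
    (hx : x ∈ Icc (0 : ℝ) 1) :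
    HasDerivWithinAt (edgeDeriv u e) (edgeDeriv₂ u e x) (Icc 0 1) x :=
  (((hu.contDiffOn_deriv e).differentiableOn (by norm_num)) x hx).hasDerivWithinAt

lemma IsC2.continuousOn_deriv₂ {u : NetFun G} (hu : IsC2 u) (e : G.edgeSet) :
    ContinuousOn (edgeDeriv₂ u e) (Icc 0 1) :=
  (hu.contDiffOn_deriv e).continuousOn_derivWithin (uniqueDiffOn_Icc zero_lt_one) (by norm_num)

lemma IsC2.zero : IsC2 (0 : NetFun G) := fun _ => contDiffOn_const

lemma IsC2.add {u w : NetFun G} (hu : IsC2 u) (hw : IsC2 w) : IsC2 (u + w) :=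
  fun e => (hu e).add (hw e)

lemma IsC2.smul (c : ℂ) {u : NetFun G} (hu : IsC2 u) : IsC2 (c • u) :=
  fun e => (contDiffOn_const (c := c)).mul (hu e)

lemma edgeDeriv_zero (e : G.edgeSet) (x : ℝ) : edgeDeriv (0 : NetFun G) e x = 0 := by
  have : comp (0 : NetFun G) e = fun _ => 0 := rfl
  simp [edgeDeriv, this]

lemma edgeDeriv_add {u w : NetFun G} (hu : IsC2 u) (hw : IsC2 w) (e : G.edgeSet) {x : ℝ}
    (hx : x ∈ Icc (0 : ℝ) 1) :
    edgeDeriv (u + w) e x = edgeDeriv u e x + edgeDeriv w e x :=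
  ((hu.hasDeriv e hx).add (hw.hasDeriv e hx)).derivWithin
    (uniqueDiffOn_Icc zero_lt_one x hx)

lemma edgeDeriv_smul (c : ℂ) {u : NetFun G} (hu : IsC2 u) (e : G.edgeSet) {x : ℝ}
    (hx : x ∈ Icc (0 : ℝ) 1) : edgeDeriv (c • u) e x = c * edgeDeriv u e x :=
  ((hu.hasDeriv e hx).const_mul c).derivWithin (uniqueDiffOn_Icc zero_lt_one x hx)

lemma edgeDeriv₂_add {u w : NetFun G} (hu : IsC2 u) (hw : IsC2 w) (e : G.edgeSet) {x : ℝ}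
    (hx : x ∈ Icc (0 : ℝ) 1) :
    edgeDeriv₂ (u + w) e x = edgeDeriv₂ u e x + edgeDeriv₂ w e x :=
  (((hu.hasDeriv₂ e hx).add (hw.hasDeriv₂ e hx)).congr
    (fun _ hy => edgeDeriv_add hu hw e hy) (edgeDeriv_add hu hw e hx)).derivWithin
    (uniqueDiffOn_Icc zero_lt_one x hx)

lemma edgeDeriv₂_smul (c : ℂ) {u : NetFun G} (hu : IsC2 u) (e : G.edgeSet) {x : ℝ}
    (hx : x ∈ Icc (0 : ℝ) 1) : edgeDeriv₂ (c • u) e x = c * edgeDeriv₂ u e x :=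
  (((hu.hasDeriv₂ e hx).const_mul c).congr
    (fun _ hy => edgeDeriv_smul c hu e hy) (edgeDeriv_smul c hu e hx)).derivWithin
    (uniqueDiffOn_Icc zero_lt_one x hx)

/-- The subspace `C²[0,1]^N` of `C[0,1]^N`. -/
def C2 (G : SimpleGraph V) : Submodule ℂ (NetFun G) where
  carrier := {u | IsC2 u}
  zero_mem' := IsC2.zero
  add_mem' := IsC2.add
  smul_mem' c _ hu := IsC2.smul c hu

/-- The Laplacian `(u_e) ↦ (u_e'')` from `C²[0,1]^N` to `C[0,1]^N`, as an unbounded operator on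
`C[0,1]^N`. -/
def laplacian (G : SimpleGraph V) : NetFun G →ₗ.[ℂ] NetFun G where
  domain := C2 G
  toFun :=
    { toFun := fun u =>
        { toFun := fun x e => edgeDeriv₂ u.1 e x
          continuous_toFun := continuous_pi fun e =>
            continuousOn_iff_continuous_domRestrict.1 (IsC2.continuousOn_deriv₂ u.2 e) }
      map_add' := fun u w => by
        ext x e
        exact edgeDeriv₂_add u.2 w.2 e x.2
      map_smul' := fun c u => by
        ext x e
        exact edgeDeriv₂_smul c u.2 e x.2 }

section

variable [DecidableEq V]

/-- The entry `d_{v,e}` of the signed incidence matrix: `1` if `v` is the head of `e`, `-1` if `v`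
is the tail of `e`, and `0` otherwise. -/
def incidence (P : EdgeParam G) (v : V) (e : G.edgeSet) : ℂ :=
  if v = P.head e then 1 else if v = P.tail e then -1 else 0

/-- The parameter in `[0,1]` at which the vertex `v` lies on the edge `e` (meaningful only if `v`
is an end of `e`). -/
def pos (P : EdgeParam G) (v : V) (e : G.edgeSet) : unitInterval :=
  if v = P.head e then 1 else 0

variable [Fintype G.edgeSet]

/-- Continuity at the vertices, together with the Kirchhoff flow condition. -/
def CKCondition (P : EdgeParam G) (u : NetFun G) : Prop :=
  (∀ (v : V) (e e' : G.edgeSet), v ∈ (e : Sym2 V) → v ∈ (e' : Sym2 V) →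
      u (pos P v e) e = u (pos P v e') e') ∧
  ∀ v : V, ∑ e : G.edgeSet, incidence P v e * edgeDeriv u e (pos P v e) = 0

/-- The anti-Kirchhoff condition: at every vertex the values sum up to zero, and the outer normal
derivatives agree. -/
def KCCondition (P : EdgeParam G) (u : NetFun G) : Prop :=
  (∀ v : V, ∑ e : G.edgeSet, incidence P v e ^ 2 * u (pos P v e) e = 0) ∧
  ∀ (v : V) (e e' : G.edgeSet), v ∈ (e : Sym2 V) → v ∈ (e' : Sym2 V) →
      incidence P v e * edgeDeriv u e (pos P v e) =
        incidence P v e' * edgeDeriv u e' (pos P v e')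

/-- The functions in `C²[0,1]^N` that satisfy the CK-condition. -/
def domainCK (P : EdgeParam G) : Submodule ℂ (NetFun G) where
  carrier := {u | IsC2 u ∧ CKCondition P u}
  zero_mem' := ⟨IsC2.zero, fun _ _ _ _ _ => rfl, fun v => by simp [edgeDeriv_zero]⟩
  add_mem' := by
    rintro u w ⟨hu, hu1, hu2⟩ ⟨hw, hw1, hw2⟩
    refine ⟨hu.add hw, fun v e e' h h' => ?_, fun v => ?_⟩
    · exact congrArg₂ (· + ·) (hu1 v e e' h h') (hw1 v e e' h h')
    · simp only [edgeDeriv_add hu hw _ (pos P v _).2, mul_add, Finset.sum_add_distrib, hu2, hw2,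
        add_zero]
  smul_mem' := by
    rintro c u ⟨hu, hu1, hu2⟩
    refine ⟨hu.smul c, fun v e e' h h' => ?_, fun v => ?_⟩
    · exact congrArg (c * ·) (hu1 v e e' h h')
    · simp only [edgeDeriv_smul c hu _ (pos P v _).2, mul_left_comm _ c, ← Finset.mul_sum, hu2,
        mul_zero]

/-- The functions in `C²[0,1]^N` that satisfy the KC-condition. -/
def domainKC (P : EdgeParam G) : Submodule ℂ (NetFun G) where
  carrier := {u | IsC2 u ∧ KCCondition P u}
  zero_mem' := ⟨IsC2.zero, fun v => by simp, fun v e e' _ _ => by simp [edgeDeriv_zero]⟩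
  add_mem' := by
    rintro u w ⟨hu, hu1, hu2⟩ ⟨hw, hw1, hw2⟩
    refine ⟨hu.add hw, fun v => ?_, fun v e e' h h' => ?_⟩
    · simp only [ContinuousMap.add_apply, Pi.add_apply, mul_add, Finset.sum_add_distrib, hu1, hw1,
        add_zero]
    · simp only [edgeDeriv_add hu hw _ (pos P v _).2, mul_add, hu2 v e e' h h', hw2 v e e' h h']
  smul_mem' := by
    rintro c u ⟨hu, hu1, hu2⟩
    refine ⟨hu.smul c, fun v => ?_, fun v e e' h h' => ?_⟩
    · simp only [ContinuousMap.smul_apply, Pi.smul_apply, smul_eq_mul, mul_left_comm _ c,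
        ← Finset.mul_sum, hu1, mul_zero]
    · simp only [edgeDeriv_smul c hu _ (pos P v _).2, mul_left_comm _ c, hu2 v e e' h h']

/-- The Laplacian with the CK-condition. -/
def laplacianCK (P : EdgeParam G) : NetFun G →ₗ.[ℂ] NetFun G :=
  (laplacian G).domRestrict (domainCK P)

/-- The Laplacian with the KC-condition. -/
def laplacianKC (P : EdgeParam G) : NetFun G →ₗ.[ℂ] NetFun G :=
  (laplacian G).domRestrict (domainKC P)

end

end QGraph

end

/-!
On the edges, an eigenfunction for `z` is determined by its value and derivative at `0`, so both
eigenvalue problems become linear algebra on the boundary data: continuity at the vertices says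
that the data factor through the vertices, Kirchhoff's condition that they lie in the orthogonal
complement, and the two operators exchange the roles of these spaces for values and for outer normal
derivatives. As the dimensions of the two spaces add up to the number of boundary values, the
resolvent exists wherever the eigenspace is trivial, and only eigenvalue multiplicities matter.

If `Γ` is bipartite with signs `σ`, then `u ↦ ±σ u'` exchanges the eigenfunctions of the two
operators for `z ≠ 0`, while for `z = 0` the multiplicities are `1` and `#E - #V + 1`. If `Γ` is not
bipartite, the multiplicities of `z = π²`, where `u_e` is a combination of `cos (π x)` and
`sin (π x)`, are `#E - #V` and `#E - #V + 2`. Finally, `Γ` is unicyclic if and only if `#E = #V`.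
-/

section DotProduct

open Module

variable {K ι V : Type*} [Field K]

variable (K) in
/-- The vectors that are constant on the fibres of `π`. When `π` maps edge ends to vertices, this
is continuity at the vertices. -/
def fiberConstant (π : ι → V) : Submodule K (ι → K) :=
  LinearMap.range (LinearMap.funLeft K K π)

lemma mem_fiberConstant {π : ι → V} {y : ι → K} :
    y ∈ fiberConstant K π ↔ ∃ f : V → K, f ∘ π = y :=
  Iff.rfl

lemma mem_fiberConstant_iff_factorsThrough {π : ι → V} {y : ι → K} :
    y ∈ fiberConstant K π ↔ y.FactorsThrough π := by
  simp only [mem_fiberConstant, Function.factorsThrough_iff, eq_comm]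

variable [Fintype ι]

/-- The annihilator of a subspace of `ι → K` for the bilinear dot product. There is no conjugation
over `ℂ`, so a nonzero vector may be orthogonal to itself. -/
def dotOrthogonal (W : Submodule K (ι → K)) : Submodule K (ι → K) :=
  LinearMap.BilinForm.orthogonal (dotProductBilin K K) W

lemma mem_dotOrthogonal {W : Submodule K (ι → K)} {y : ι → K} :
    y ∈ dotOrthogonal W ↔ ∀ w ∈ W, w ⬝ᵥ y = 0 :=
  Iff.rfl

lemma finrank_dotOrthogonal_add_finrank (W : Submodule K (ι → K)) :
    finrank K (dotOrthogonal W) + finrank K W = Fintype.card ι := by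
  classical
  have h : (dotOrthogonal W).map (dotProductEquiv K ι).toLinearMap = W.dualAnnihilator := by
    ext φ
    obtain ⟨y, rfl⟩ := (dotProductEquiv K ι).surjective φ
    simp only [Submodule.mem_map_equiv, LinearEquiv.symm_apply_apply, mem_dotOrthogonal,
      Submodule.mem_dualAnnihilator, dotProductEquiv_apply_apply, dotProduct_comm y]
  rw [← LinearEquiv.finrank_map_eq (dotProductEquiv K ι), h, add_comm,
    Subspace.finrank_add_finrank_dualAnnihilator_eq, finrank_fintype_fun_eq_card]

variable (K) in
/-- The vectors whose sum over each fibre of `π` vanishes. When `π` maps edge ends to vertices,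
this is Kirchhoff's flow condition. -/
def fiberBalanced (π : ι → V) : Submodule K (ι → K) :=
  dotOrthogonal (fiberConstant K π)

lemma mem_fiberBalanced {π : ι → V} {y : ι → K} :
    y ∈ fiberBalanced K π ↔ ∀ f : V → K, (f ∘ π) ⬝ᵥ y = 0 := by
  simp only [fiberBalanced, mem_dotOrthogonal, mem_fiberConstant, forall_exists_index,
    forall_apply_eq_imp_iff]

lemma mem_fiberBalanced_iff_sum_fiber [DecidableEq V] {π : ι → V} {y : ι → K} :
    y ∈ fiberBalanced K π ↔ ∀ v, ∑ i with π i = v, y i = 0 := by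
  rw [mem_fiberBalanced]
  refine ⟨fun h v => ?_, fun h f => ?_⟩
  · simpa [dotProduct, Pi.single_apply, Finset.sum_filter] using h (Pi.single v 1)
  · have hmaps : ∀ i ∈ Finset.univ, π i ∈ Finset.univ.image π := fun i hi =>
      Finset.mem_image_of_mem π hi
    rw [dotProduct, ← Finset.sum_fiberwise_of_maps_to hmaps]
    refine Finset.sum_eq_zero fun v _ => ?_
    calc ∑ i with π i = v, f (π i) * y i = ∑ i with π i = v, f v * y i :=
          Finset.sum_congr rfl fun i hi => by rw [(Finset.mem_filter.1 hi).2]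
      _ = 0 := by rw [← Finset.mul_sum, h, mul_zero]

end DotProduct

section Connected

variable {V : Type*} {G : SimpleGraph V}

lemma eq_of_connected_of_forall_adj {α : Type*} (hG : G.Connected) {f : V → α}
    (hf : ∀ v w, G.Adj v w → f v = f w) (v w : V) : f v = f w := by
  obtain ⟨p⟩ := hG v w
  induction p with
  | nil => rfl
  | cons h _ ih => exact (hf _ _ h).trans ih

lemma exists_sign_of_isBipartite {R : Type*} [Ring R] (hb : G.IsBipartite) :
    ∃ σ : V → R, (∀ v, σ v = 1 ∨ σ v = -1) ∧ ∀ v w, G.Adj v w → σ w = -σ v := by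
  obtain ⟨c⟩ := hb
  refine ⟨fun v => if c v = 0 then 1 else -1, fun v => by grind, fun v w h => ?_⟩
  have := c.valid h
  grind

lemma isBipartite_of_forall_adj_eq_neg {K : Type*} [Field K] (h2 : (2 : K) ≠ 0)
    (hG : G.Connected) {f : V → K} (hf : ∀ v w, G.Adj v w → f w = -f v) (hf0 : f ≠ 0) :
    G.IsBipartite := by
  obtain ⟨v₀, hv₀⟩ := Function.ne_iff.1 hf0
  have hsq (v : V) : f v = f v₀ ∨ f v = -f v₀ := by
    rw [← sq_eq_sq_iff_eq_or_eq_neg]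
    exact eq_of_connected_of_forall_adj hG (f := fun v => f v ^ 2)
      (fun v w h => by rw [hf v w h, neg_sq]) v v₀
  classical
  refine (SimpleGraph.Coloring.mk (α := Bool) (fun v => decide (f v = f v₀)) ?_).colorable
  intro v w h
  have hne : -f v₀ ≠ f v₀ := fun h0 =>
    mul_ne_zero h2 hv₀ (by linear_combination -h0)
  have hvw := hf v w h
  rcases hsq v with hv | hv <;> simp [hvw, hv, hne]

end Connected

namespace EdgeParam

open Module

variable {V : Type*} {G : SimpleGraph V} (P : EdgeParam G)

lemma adj (e : G.edgeSet) : G.Adj (P.tail e) (P.head e) := by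
  rw [← SimpleGraph.mem_edgeSet, ← P.endpoints]
  exact e.2

lemma tail_ne_head (e : G.edgeSet) : P.tail e ≠ P.head e := (P.adj e).ne

lemma mem_iff {v : V} {e : G.edgeSet} : v ∈ (e : Sym2 V) ↔ v = P.tail e ∨ v = P.head e := by
  rw [P.endpoints, Sym2.mem_iff]

lemma forall_adj_of_forall_edge {r : V → V → Prop} (hr : ∀ v w, r v w → r w v)
    (h : ∀ e, r (P.tail e) (P.head e)) (v w : V) (hvw : G.Adj v w) : r v w := by
  obtain ⟨e, he⟩ : ∃ e : G.edgeSet, s(v, w) = e := ⟨⟨s(v, w), hvw⟩, rfl⟩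
  rw [P.endpoints] at he
  rcases Sym2.eq_iff.1 he with ⟨rfl, rfl⟩ | ⟨rfl, rfl⟩
  · exact h _
  · exact hr _ _ (h _)

/-- The vertex at which an edge end lies, where `Sum.inl e` and `Sum.inr e` are the ends of `e` at
the parameters `0` and `1`. -/
def vertex : G.edgeSet ⊕ G.edgeSet → V := Sum.elim P.tail P.head

lemma sum_fiber_vertex [Fintype G.edgeSet] [DecidableEq V] {R : Type*} [AddCommMonoid R]
    (g : G.edgeSet ⊕ G.edgeSet → R) (v : V) :
    ∑ i with P.vertex i = v, g i =
      ∑ e : G.edgeSet, if v = P.head e then g (Sum.inr e)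
        else if v = P.tail e then g (Sum.inl e) else 0 := by
  rw [Finset.sum_filter, Fintype.sum_sum_type, ← Finset.sum_add_distrib]
  refine Finset.sum_congr rfl fun e _ => ?_
  have := P.tail_ne_head e
  simp only [vertex, Sum.elim_inl, Sum.elim_inr]
  grind

variable {K : Type*} [Field K]

/-- `f ↦ (f (head e) + ε f (tail e))_e`: the coboundary map for `ε = -1`, and the transpose of the
unsigned incidence matrix for `ε = 1`. -/
def coboundary (ε : K) : (V → K) →ₗ[K] (G.edgeSet → K) :=
  LinearMap.funLeft K K P.head + ε • LinearMap.funLeft K K P.tail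

lemma coboundary_apply (ε : K) (f : V → K) (e : G.edgeSet) :
    P.coboundary ε f e = f (P.head e) + ε * f (P.tail e) := rfl

lemma mem_ker_coboundary {ε : K} {f : V → K} :
    f ∈ LinearMap.ker (P.coboundary ε) ↔ ∀ e, f (P.head e) = -(ε * f (P.tail e)) := by
  simp only [LinearMap.mem_ker, funext_iff, coboundary_apply, Pi.zero_apply, eq_neg_iff_add_eq_zero]

lemma finrank_ker_coboundary_eq_one (hG : G.Connected) {ε : K} {σ : V → K} (hσ : ∀ v, σ v ≠ 0)
    (hker : σ ∈ LinearMap.ker (P.coboundary ε)) :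
    finrank K (LinearMap.ker (P.coboundary ε)) = 1 := by
  obtain ⟨v₀⟩ := hG.nonempty
  refine finrank_eq_one (⟨σ, hker⟩ : LinearMap.ker (P.coboundary ε)) ?_ ?_
  · exact fun h => hσ v₀ (congrFun (congrArg Subtype.val h) v₀)
  rintro ⟨f, hf⟩
  have hratio (v : V) : f v₀ / σ v₀ = f v / σ v :=
    eq_of_connected_of_forall_adj hG (f := fun v => f v / σ v)
      (P.forall_adj_of_forall_edge (fun _ _ => Eq.symm) fun e => by
        rw [div_eq_div_iff (hσ _) (hσ _), P.mem_ker_coboundary.1 hf, P.mem_ker_coboundary.1 hker]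
        ring) v₀ v
  refine ⟨f v₀ / σ v₀, Subtype.ext (funext fun v => ?_)⟩
  simp only [SetLike.mk_smul_mk, Pi.smul_apply, smul_eq_mul, hratio v, div_mul_cancel₀ _ (hσ v)]

lemma ker_coboundary_one_eq_bot_of_not_isBipartite (h2 : (2 : K) ≠ 0) (hG : G.Connected)
    (hb : ¬ G.IsBipartite) : LinearMap.ker (P.coboundary (1 : K)) = ⊥ := by
  refine (Submodule.eq_bot_iff _).2 fun f hf => ?_
  by_contra hf0
  have hedge (e : G.edgeSet) : f (P.head e) = -f (P.tail e) := by
    rw [P.mem_ker_coboundary.1 hf, one_mul]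
  refine hb (isBipartite_of_forall_adj_eq_neg h2 hG ?_ hf0)
  exact P.forall_adj_of_forall_edge (fun v w h => by rw [h, neg_neg]) hedge

variable [Fintype G.edgeSet]

/-- The edge weights `β` with `∑ₑ (f (head e) + ε f (tail e)) β e = 0` for all `f`. For `ε = -1` it
is the cycle space of the graph. -/
def cycleSpace (ε : K) : Submodule K (G.edgeSet → K) :=
  dotOrthogonal (LinearMap.range (P.coboundary ε))

lemma mem_cycleSpace {ε : K} {β : G.edgeSet → K} :
    β ∈ P.cycleSpace ε ↔ Sum.elim (ε • β) β ∈ fiberBalanced K P.vertex := by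
  simp only [cycleSpace, mem_dotOrthogonal, LinearMap.mem_range, forall_exists_index,
    forall_apply_eq_imp_iff, mem_fiberBalanced]
  refine forall_congr' fun f => Eq.congr_left ?_
  simp only [dotProduct, coboundary_apply, Fintype.sum_sum_type, vertex, Function.comp_apply,
    Sum.elim_inl, Sum.elim_inr, Pi.smul_apply, smul_eq_mul, ← Finset.sum_add_distrib]
  exact Finset.sum_congr rfl fun e _ => by ring

variable [Fintype V]

lemma finrank_cycleSpace_add_card (ε : K) :
    finrank K (P.cycleSpace ε) + Fintype.card V =
      Fintype.card G.edgeSet + finrank K (LinearMap.ker (P.coboundary ε)) := by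
  have hdual := finrank_dotOrthogonal_add_finrank (LinearMap.range (P.coboundary ε))
  have hrank := (P.coboundary ε).finrank_range_add_finrank_ker
  rw [finrank_fintype_fun_eq_card] at hrank
  rw [cycleSpace]
  omega

variable (K) in
lemma finrank_cycleSpace_neg_one (hG : G.Connected) :
    finrank K (P.cycleSpace (-1 : K)) + Fintype.card V = Fintype.card G.edgeSet + 1 := by
  rw [finrank_cycleSpace_add_card, P.finrank_ker_coboundary_eq_one hG (σ := 1)]
  · exact fun _ => one_ne_zero
  · exact P.mem_ker_coboundary.2 fun e => by simp

variable (K) in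
lemma finrank_cycleSpace_one_of_isBipartite (hG : G.Connected) (hb : G.IsBipartite) :
    finrank K (P.cycleSpace (1 : K)) + Fintype.card V = Fintype.card G.edgeSet + 1 := by
  obtain ⟨σ, hσ, hadj⟩ := exists_sign_of_isBipartite (R := K) hb
  rw [finrank_cycleSpace_add_card, P.finrank_ker_coboundary_eq_one hG (σ := σ)]
  · exact fun v => by rcases hσ v with h | h <;> simp [h]
  · exact P.mem_ker_coboundary.2 fun e => by rw [one_mul, hadj _ _ (P.adj e)]

variable (K) in
lemma finrank_cycleSpace_one_of_not_isBipartite (h2 : (2 : K) ≠ 0) (hG : G.Connected)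
    (hb : ¬ G.IsBipartite) :
    finrank K (P.cycleSpace (1 : K)) + Fintype.card V = Fintype.card G.edgeSet := by
  rw [finrank_cycleSpace_add_card, P.ker_coboundary_one_eq_bot_of_not_isBipartite h2 hG hb,
    finrank_bot, add_zero]

end EdgeParam

section Circuit

variable {V : Type*} {G : SimpleGraph V}

/-- A circuit is a connected subgraph that is regular of degree two. -/
def IsCircuit (H : G.Subgraph) : Prop :=
  H.Connected ∧ ∀ v ∈ H.verts, (H.neighborSet v).ncard = 2

lemma isCircuit_toSubgraph_of_isCycle {u : V} {p : G.Walk u u} (hp : p.IsCycle) :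
    IsCircuit p.toSubgraph :=
  ⟨p.toSubgraph_connected, fun _ hv =>
    hp.ncard_neighborSet_toSubgraph_eq_two (p.mem_verts_toSubgraph.1 hv)⟩

namespace IsCircuit

variable {H H' : G.Subgraph}

lemma exists_adj (h : IsCircuit H) {v : V} (hv : v ∈ H.verts) : ∃ w, H.Adj v w := by
  have hdeg : (H.neighborSet v).ncard ≠ 0 := by
    rw [h.2 v hv]
    exact two_ne_zero
  exact Set.nonempty_of_ncard_ne_zero hdeg

lemma le_of_edgeSet_subset (h : IsCircuit H) (he : H.edgeSet ⊆ H'.edgeSet) : H ≤ H' := by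
  have hadj {v w : V} (hvw : H.Adj v w) : H'.Adj v w :=
    SimpleGraph.Subgraph.mem_edgeSet.1 (he (SimpleGraph.Subgraph.mem_edgeSet.2 hvw))
  refine ⟨fun v hv => ?_, fun v w => hadj⟩
  obtain ⟨w, hw⟩ := h.exists_adj hv
  exact (hadj hw).fst_mem

lemma eq_of_edgeSet_eq (h : IsCircuit H) (h' : IsCircuit H') (he : H.edgeSet = H'.edgeSet) :
    H = H' :=
  le_antisymm (h.le_of_edgeSet_subset he.le) (h'.le_of_edgeSet_subset he.ge)

end IsCircuit

/-- The indicator function of the edges of a subgraph, modulo two. -/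
noncomputable def edgeIndicator (H : G.Subgraph) : G.edgeSet → ZMod 2 :=
  ((↑) ⁻¹' H.edgeSet : Set G.edgeSet).indicator 1

lemma edgeSet_eq_of_edgeIndicator_eq {H H' : G.Subgraph} (h : edgeIndicator H = edgeIndicator H') :
    H.edgeSet = H'.edgeSet :=
  (Set.preimage_eq_preimage' (by rw [Subtype.range_coe]; exact H.edgeSet_subset)
    (by rw [Subtype.range_coe]; exact H'.edgeSet_subset)).1 (Set.indicator_one_inj (ZMod 2) h)

lemma IsCircuit.edgeIndicator_ne_zero {H : G.Subgraph} (h : IsCircuit H) :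
    edgeIndicator H ≠ 0 := by
  obtain ⟨v, hv⟩ := h.1.nonempty
  obtain ⟨w, hw⟩ := h.exists_adj hv
  refine Function.ne_iff.2 ⟨⟨s(v, w), hw.adj_sub⟩, ?_⟩
  rw [edgeIndicator, Set.indicator_of_mem (by exact hw)]
  exact one_ne_zero

lemma ncard_neighborSet_eq_card_edges [Fintype G.edgeSet] (H : G.Subgraph) (v : V)
    [DecidablePred fun e : G.edgeSet => v ∈ (e : Sym2 V) ∧ (e : Sym2 V) ∈ H.edgeSet] :
    (H.neighborSet v).ncard =
      Finset.card {e : G.edgeSet | v ∈ (e : Sym2 V) ∧ (e : Sym2 V) ∈ H.edgeSet} := by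
  rw [← Set.ncard_coe_finset]
  refine Set.ncard_congr (fun w hw => ⟨s(v, w), H.edgeSet_subset hw⟩) ?_ ?_ ?_
  · intro w hw
    simpa using hw
  · intro w w' _ _ hww
    exact Sym2.congr_right.1 (congrArg Subtype.val hww)
  · rintro ⟨e, he⟩ hv
    simp only [Finset.coe_filter, Finset.mem_univ, true_and, Set.mem_ofPred_eq] at hv
    obtain ⟨⟨w, rfl⟩, hw⟩ := hv
    exact ⟨w, hw, rfl⟩

lemma IsCircuit.edgeIndicator_mem_cycleSpace [Fintype G.edgeSet] (P : EdgeParam G) {H : G.Subgraph}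
    (h : IsCircuit H) : edgeIndicator H ∈ P.cycleSpace (-1) := by
  classical
  rw [P.mem_cycleSpace, CharTwo.neg_eq, one_smul, mem_fiberBalanced_iff_sum_fiber]
  intro v
  have hdeg : ∑ i with P.vertex i = v, Sum.elim (edgeIndicator H) (edgeIndicator H) i =
      (H.neighborSet v).ncard := by
    rw [P.sum_fiber_vertex, ncard_neighborSet_eq_card_edges, ← Finset.sum_boole]
    refine Finset.sum_congr rfl fun e _ => ?_
    simp only [P.mem_iff, Sum.elim_inl, Sum.elim_inr, edgeIndicator, Set.indicator_apply,
      Set.mem_preimage, Pi.one_apply]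
    grind
  rw [hdeg]
  by_cases hv : v ∈ H.verts
  · rw [h.2 v hv]
    rfl
  · have hempty : H.neighborSet v = ∅ :=
      Set.eq_empty_of_forall_notMem fun w hw => hv (H.edge_vert hw)
    rw [hempty, Set.ncard_empty, Nat.cast_zero]

lemma exists_isCycle_of_card_le [Finite V] (hG : G.Connected)
    (hc : Nat.card V ≤ Nat.card G.edgeSet) : ∃ (u : V) (p : G.Walk u u), p.IsCycle := by
  by_contra! hacyclic
  have htree : G.IsTree := ⟨hG, fun u p hp => hacyclic u p hp⟩
  have := (SimpleGraph.isTree_iff_connected_and_card.1 htree).2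
  omega

end Circuit

namespace IsUnicyclic

variable {V : Type*} [Fintype V] {G : SimpleGraph V} [Fintype G.edgeSet]

lemma card_edgeSet_le (h : IsUnicyclic G) (hG : G.Connected) :
    Fintype.card G.edgeSet ≤ Fintype.card V := by
  obtain ⟨H, -, huniq⟩ := h
  rw [← Nat.card_eq_fintype_card, ← Nat.card_eq_fintype_card]
  by_contra! hlt
  obtain ⟨u, p, hp⟩ := exists_isCycle_of_card_le hG hlt.le
  obtain ⟨e, he⟩ : ∃ e, e ∈ p.edges :=
    List.exists_mem_of_ne_nil _ fun h0 => hp.not_nil (by simpa using h0)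
  induction e with | h x y =>
  have hle := G.deleteEdges_le {s(x, y)}
  have hnb : ¬ G.IsBridge s(x, y) := fun hb => hb.notMem_edges_of_isCycle hp he
  have hconn := hG.connected_delete_edge_of_not_isBridge hnb
  have hcard : Nat.card (G.deleteEdges {s(x, y)}).edgeSet + 1 = Nat.card G.edgeSet := by
    rw [SimpleGraph.edgeSet_deleteEdges]
    exact Set.ncard_sdiff_singleton_add_one (p.edges_subset_edgeSet he) (Set.toFinite _)
  obtain ⟨u', p', hp'⟩ := exists_isCycle_of_card_le hconn (by omega)
  have heq : p.toSubgraph = (p'.mapLe hle).toSubgraph :=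
    (huniq _ (isCircuit_toSubgraph_of_isCycle hp)).trans
      (huniq _ (isCircuit_toSubgraph_of_isCycle (hp'.mapLe hle))).symm
  rw [← SimpleGraph.Walk.mem_edges_toSubgraph, heq, SimpleGraph.Walk.mem_edges_toSubgraph,
    SimpleGraph.Walk.edges_mapLe_eq_edges] at he
  simpa using p'.edges_subset_edgeSet he

end IsUnicyclic

lemma isUnicyclic_iff_card_eq {V : Type*} [Fintype V] {G : SimpleGraph V} [Fintype G.edgeSet]
    (P : EdgeParam G) (hG : G.Connected) :
    IsUnicyclic G ↔ Fintype.card G.edgeSet = Fintype.card V := by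
  have hdim := P.finrank_cycleSpace_neg_one (ZMod 2) hG
  constructor
  · intro h
    obtain ⟨H, hH : IsCircuit H, -⟩ := id h
    have hpos : 0 < Module.finrank (ZMod 2) (P.cycleSpace (-1 : ZMod 2)) :=
      Module.finrank_pos_iff_exists_ne_zero.2 ⟨⟨_, hH.edgeIndicator_mem_cycleSpace P⟩, fun h0 =>
        hH.edgeIndicator_ne_zero (congrArg Subtype.val h0)⟩
    have := h.card_edgeSet_le hG
    omega
  · intro hcard
    obtain ⟨u, p, hp⟩ := exists_isCycle_of_card_le hG
      (by rw [Nat.card_eq_fintype_card, Nat.card_eq_fintype_card, hcard])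
    replace hp := isCircuit_toSubgraph_of_isCycle hp
    refine ⟨p.toSubgraph, hp, fun H (hH : IsCircuit H) => ?_⟩
    refine hH.eq_of_edgeSet_eq hp (edgeSet_eq_of_edgeIndicator_eq ?_)
    obtain ⟨c, hc⟩ := (finrank_eq_one_iff_of_nonzero' ⟨_, hp.edgeIndicator_mem_cycleSpace P⟩
      fun h0 => hp.edgeIndicator_ne_zero (congrArg Subtype.val h0)).1
      (by rw [hcard, add_comm] at hdim; exact Nat.add_left_cancel hdim)
      ⟨_, hH.edgeIndicator_mem_cycleSpace P⟩
    replace hc : c • edgeIndicator p.toSubgraph = edgeIndicator H := congrArg Subtype.val hc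
    have hc0 : c ≠ 0 := by
      rintro rfl
      exact hH.edgeIndicator_ne_zero (by rw [← hc, zero_smul])
    have hc1 : c = 1 := (by decide : ∀ c : ZMod 2, c ≠ 0 → c = 1) c hc0
    rw [← hc, hc1, one_smul]

namespace UnboundedOp

variable {X : Type*} [AddCommGroup X] [Module ℂ X] {A : X →ₗ.[ℂ] X} {z : ℂ} {u : X}

lemma mem_eigenspace : u ∈ eigenspace A z ↔ ∃ h : u ∈ A.domain, A ⟨u, h⟩ = z • u := by
  simp only [eigenspace, Submodule.mem_map, LinearMap.mem_ker]
  constructor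
  · rintro ⟨⟨w, hw⟩, h, rfl⟩
    exact ⟨hw, sub_eq_zero.1 h⟩
  · rintro ⟨hu, h⟩
    exact ⟨⟨u, hu⟩, sub_eq_zero.2 h, rfl⟩

lemma eigenspace_eq_bot_of_mem_resolventSet [TopologicalSpace X] (hz : z ∈ resolventSet A) :
    eigenspace A z = ⊥ := by
  obtain ⟨R, -, hR⟩ := hz
  refine (Submodule.eq_bot_iff _).2 fun u hu => ?_
  obtain ⟨h, hAu⟩ := mem_eigenspace.1 hu
  simpa only [hAu, sub_self, map_zero] using (hR ⟨u, h⟩).symm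

end UnboundedOp

noncomputable section

namespace QGraph

section Derivative

open Set

variable {E : Type*} [NormedAddCommGroup E] [NormedSpace ℝ E]

/-- `u` is differentiable on `[0,1]`, one-sided at `0` and at `1`, with derivative `u'`. -/
def IsDeriv (u u' : C(unitInterval, E)) : Prop :=
  ∀ x : unitInterval, HasDerivWithinAt (IccExtend zero_le_one u) (u' x) (Icc 0 1) x

variable {u u' v v' : C(unitInterval, E)}

lemma IsDeriv.of_hasDerivAt (f : ℝ → E) (hf : ∀ x : unitInterval, u x = f x)
    (h : ∀ x : unitInterval, HasDerivAt f (u' x) x) : IsDeriv u u' := fun x =>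
  (h x).hasDerivWithinAt.congr_of_mem
    (fun y hy => (IccExtend_of_mem _ _ hy).trans (hf ⟨y, hy⟩)) x.2

namespace IsDeriv

lemma add (hu : IsDeriv u u') (hv : IsDeriv v v') : IsDeriv (u + v) (u' + v') :=
  fun x => (hu x).add (hv x)

lemma sub (hu : IsDeriv u u') (hv : IsDeriv v v') : IsDeriv (u - v) (u' - v') :=
  fun x => (hu x).sub (hv x)

lemma smul {𝕜 : Type*} [NormedField 𝕜] [NormedAlgebra ℝ 𝕜] [NormedSpace 𝕜 E]
    [IsScalarTower ℝ 𝕜 E] {φ φ' : C(unitInterval, 𝕜)} (hφ : IsDeriv φ φ') (hu : IsDeriv u u') :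
    IsDeriv (φ • u) (φ • u' + φ' • u) := by
  intro x
  have := (hφ x).smul (hu x)
  rwa [IccExtend_val, IccExtend_val] at this

lemma const (a : E) : IsDeriv (ContinuousMap.const unitInterval a) 0 :=
  fun x => hasDerivWithinAt_const (x : ℝ) _ a

lemma smul_const {𝕜 : Type*} [NormedField 𝕜] [NormedAlgebra ℝ 𝕜] [NormedSpace 𝕜 E]
    [IsScalarTower ℝ 𝕜 E] {φ φ' : C(unitInterval, 𝕜)} (hφ : IsDeriv φ φ') (a : E) :
    IsDeriv (φ • ContinuousMap.const unitInterval a)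
      (φ' • ContinuousMap.const unitInterval a) := by
  simpa using hφ.smul (const a)

lemma const_smul {𝕜 : Type*} [NormedField 𝕜] [NormedAlgebra ℝ 𝕜] [NormedSpace 𝕜 E]
    [IsScalarTower ℝ 𝕜 E] (z : 𝕜) (hu : IsDeriv u u') : IsDeriv (z • u) (z • u') :=
  fun x => (hu x).const_smul z

lemma derivWithin_eq (hu : IsDeriv u u') (x : unitInterval) :
    derivWithin (IccExtend zero_le_one u) (Icc 0 1) x = u' x :=
  (hu x).derivWithin (uniqueDiffOn_Icc zero_lt_one x x.2)

lemma unique (hu : IsDeriv u u') (hv : IsDeriv u v') : u' = v' := by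
  ext x
  rw [← hu.derivWithin_eq, hv.derivWithin_eq]

lemma eq_const (hu : IsDeriv u 0) : u = ContinuousMap.const unitInterval (u 0) := by
  ext x
  have h := constant_of_derivWithin_zero (fun y hy => (hu ⟨y, hy⟩).differentiableWithinAt)
    (fun y hy => hu.derivWithin_eq ⟨y, Ico_subset_Icc_self hy⟩) x x.2
  rwa [IccExtend_val, IccExtend_left] at h

end IsDeriv

end Derivative

section Fundamental

/-- `c` and `s` are the solutions of `u'' = -z u` on `[0,1]` with the Cauchy data `(1, 0)` and
`(0, 1)` at `0`. -/
structure IsFundamental (z : ℂ) (c s : C(unitInterval, ℂ)) : Prop where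
  deriv_cos : IsDeriv c (-(z • s))
  deriv_sin : IsDeriv s c
  cos_zero : c 0 = 1
  sin_zero : s 0 = 0

/-- The function `x ↦ cos (ω x)` on `[0,1]`. -/
def cosFun (ω : ℂ) : C(unitInterval, ℂ) where
  toFun x := Complex.cos (ω * (x : ℝ))
  continuous_toFun := by fun_prop

/-- The function `x ↦ sin (ω x) / ω` on `[0,1]`, meaningful only for `ω ≠ 0`. -/
def sincFun (ω : ℂ) : C(unitInterval, ℂ) where
  toFun x := Complex.sin (ω * (x : ℝ)) / ω
  continuous_toFun := by fun_prop

/-- The function `x ↦ x` on `[0,1]`. -/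
def idFun : C(unitInterval, ℂ) where
  toFun x := (x : ℝ)
  continuous_toFun := by fun_prop

lemma isFundamental_cos_sinc {ω : ℂ} (hω : ω ≠ 0) :
    IsFundamental (ω ^ 2) (cosFun ω) (sincFun ω) := by
  have hlin (x : ℝ) : HasDerivAt (fun y : ℝ => ω * (y : ℂ)) ω x := by
    simpa using (Complex.ofRealCLM.hasDerivAt (x := x)).const_mul ω
  constructor
  · refine .of_hasDerivAt (fun x => Complex.cos (ω * x)) (fun _ => rfl) fun x => ?_
    refine ((Complex.hasDerivAt_cos _).comp_of_eq (x : ℝ) (hlin x) rfl).congr_deriv ?_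
    change _ = -(ω ^ 2 * (Complex.sin (ω * (x : ℝ)) / ω))
    field_simp
  · refine .of_hasDerivAt (fun x => Complex.sin (ω * x) / ω) (fun _ => rfl) fun x => ?_
    refine (((Complex.hasDerivAt_sin _).comp_of_eq (x : ℝ) (hlin x) rfl).div_const ω).congr_deriv ?_
    exact mul_div_cancel_right₀ _ hω
  · simp [cosFun]
  · simp [sincFun]

lemma isFundamental_zero : IsFundamental 0 1 idFun := by
  constructor
  · convert! IsDeriv.const (1 : ℂ) using 1
    ext x
    simp
  · exact .of_hasDerivAt (fun x => (x : ℂ)) (fun _ => rfl) fun x =>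
      Complex.ofRealCLM.hasDerivAt (x := (x : ℝ))
  · rfl
  · simp [idFun]

lemma exists_isFundamental (z : ℂ) : ∃ c s, IsFundamental z c s := by
  rcases eq_or_ne z 0 with rfl | hz
  · exact ⟨_, _, isFundamental_zero⟩
  · obtain ⟨ω, rfl⟩ := IsAlgClosed.exists_pow_nat_eq z (n := 2) two_pos
    exact ⟨_, _, isFundamental_cos_sinc (ne_zero_pow two_ne_zero hz)⟩

variable {E : Type*} [NormedAddCommGroup E] [NormedSpace ℂ E]

/-- The function `c a + s b`, for coefficients `p = (a, b)`. -/
def combination (c s : C(unitInterval, ℂ)) : E × E →ₗ[ℂ] C(unitInterval, E) where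
  toFun p := c • ContinuousMap.const unitInterval p.1 + s • ContinuousMap.const unitInterval p.2
  map_add' p q := by
    ext x
    simp [add_add_add_comm]
  map_smul' z p := by
    ext x
    simp [smul_comm z]

lemma combination_apply (c s : C(unitInterval, ℂ)) (p : E × E) (x : unitInterval) :
    combination c s p x = c x • p.1 + s x • p.2 := rfl

namespace IsFundamental

variable {z : ℂ} {c s : C(unitInterval, ℂ)}

lemma wronskian (h : IsFundamental z c s) (x : unitInterval) : c x * c x + z * (s x * s x) = 1 := by
  have hd : IsDeriv (c • c + z • (s • s)) 0 := by
    convert! (h.deriv_cos.smul h.deriv_cos).add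
      ((h.deriv_sin.smul h.deriv_sin).const_smul z) using 1
    ext x
    simp only [ContinuousMap.zero_apply, smul_eq_mul, smul_add, ContinuousMap.add_apply,
      ContinuousMap.mul_apply, ContinuousMap.neg_apply, ContinuousMap.coe_smul, Pi.smul_apply]
    ring
  simpa [h.cos_zero, h.sin_zero] using DFunLike.congr_fun hd.eq_const x

variable (h : IsFundamental z c s)
include h

variable [NormedSpace ℝ E] [IsScalarTower ℝ ℂ E]

lemma isDeriv_combination (p : E × E) :
    IsDeriv (combination c s p) (combination (-(z • s)) c p) :=
  (h.deriv_cos.smul_const p.1).add (h.deriv_sin.smul_const p.2)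

lemma isDeriv_combination_deriv (p : E × E) :
    IsDeriv (combination (-(z • s)) c p) (-(z • combination c s p)) := by
  have hs : IsDeriv (-(z • s)) (-(z • c)) := by
    simpa only [neg_smul] using h.deriv_sin.const_smul (-z)
  convert! (hs.smul_const p.1).add (h.deriv_cos.smul_const p.2) using 1
  ext x
  simp [combination_apply, mul_smul, add_comm]

lemma eq_combination {u u' : C(unitInterval, E)} (hu : IsDeriv u u')
    (hu' : IsDeriv u' (-(z • u))) : u = combination c s (u 0, u' 0) := by
  have hα : IsDeriv (c • u - s • u') 0 := by
    convert! (h.deriv_cos.smul hu).sub (h.deriv_sin.smul hu') using 1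
    ext x
    simp only [ContinuousMap.zero_apply, ContinuousMap.add_apply, ContinuousMap.sub_apply,
      ContinuousMap.neg_apply, ContinuousMap.coe_smul, ContinuousMap.coe_smul', Pi.smul_apply,
      Pi.smul_apply']
    module
  have hβ : IsDeriv (z • (s • u) + c • u') 0 := by
    convert! ((h.deriv_sin.smul hu).const_smul z).add (h.deriv_cos.smul hu') using 1
    ext x
    simp only [ContinuousMap.zero_apply, ContinuousMap.add_apply, ContinuousMap.neg_apply,
      ContinuousMap.coe_smul, ContinuousMap.coe_smul', Pi.smul_apply, Pi.smul_apply']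
    module
  ext x
  have hαx : c x • u x - s x • u' x = u 0 := by
    simpa [h.cos_zero, h.sin_zero] using DFunLike.congr_fun hα.eq_const x
  have hβx : z • s x • u x + c x • u' x = u' 0 := by
    simpa [h.cos_zero, h.sin_zero] using DFunLike.congr_fun hβ.eq_const x
  calc u x = (c x * c x + z * (s x * s x)) • u x := by rw [h.wronskian, one_smul]
    _ = c x • (c x • u x - s x • u' x) + s x • (z • s x • u x + c x • u' x) := by module
    _ = combination c s (u 0, u' 0) x := by rw [hαx, hβx]; rfl

lemma combination_injective : Function.Injective (combination c s : E × E →ₗ[ℂ] _) := by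
  refine (injective_iff_map_eq_zero _).2 fun p hp => ?_
  have hp' : combination (-(z • s)) c p = 0 := by
    have := h.isDeriv_combination p
    rw [hp] at this
    exact this.unique (IsDeriv.const 0)
  have h0 := DFunLike.congr_fun hp 0
  have h0' := DFunLike.congr_fun hp' 0
  simp only [combination_apply, h.cos_zero, one_smul, h.sin_zero, zero_smul, add_zero,
    ContinuousMap.zero_apply, ContinuousMap.neg_apply, ContinuousMap.coe_smul, Pi.smul_apply,
    smul_zero, neg_zero, zero_add] at h0 h0'
  exact Prod.ext h0 h0'

end IsFundamental

end Fundamental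

section Duhamel

open MeasureTheory Set

variable {E : Type*} [NormedAddCommGroup E] [NormedSpace ℂ E]

/-- Multiplication by a scalar function, as a bounded operator. -/
def mulOperator (φ : C(unitInterval, ℂ)) : C(unitInterval, E) →L[ℂ] C(unitInterval, E) :=
  LinearMap.mkContinuous
    { toFun f := φ • f
      map_add' f g := smul_add φ f g
      map_smul' z f := by
        ext x
        exact smul_comm (φ x) z (f x) } ‖φ‖ fun f =>
    (ContinuousMap.norm_le _ (by positivity)).2 fun x => (norm_smul_le _ _).trans <|
      mul_le_mul (φ.norm_coe_le_norm x) (f.norm_coe_le_norm x) (norm_nonneg _) (norm_nonneg _)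

variable [NormedSpace ℝ E] [IsScalarTower ℝ ℂ E]

/-- The Volterra operator `f ↦ ∫₀ˣ f`. -/
def primitive : C(unitInterval, E) →L[ℂ] C(unitInterval, E) :=
  LinearMap.mkContinuous
    { toFun f :=
        { toFun x := ∫ t in (0 : ℝ)..x, IccExtend zero_le_one f t
          continuous_toFun := (intervalIntegral.continuous_primitive
            f.continuous.Icc_extend'.intervalIntegrable 0).comp continuous_subtype_val }
      map_add' f g := by
        ext x
        exact intervalIntegral.integral_add (f.continuous.Icc_extend'.intervalIntegrable _ _)
          (g.continuous.Icc_extend'.intervalIntegrable _ _)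
      map_smul' z f := by
        ext x
        exact intervalIntegral.integral_smul z _ } 1 <| by
    intro f
    rw [one_mul, ContinuousMap.norm_le _ (norm_nonneg _)]
    intro x
    refine (intervalIntegral.norm_integral_le_of_norm_le_const (C := ‖f‖) fun t _ =>
      f.norm_coe_le_norm _).trans ?_
    rw [sub_zero, abs_of_nonneg x.2.1]
    exact mul_le_of_le_one_right (norm_nonneg _) x.2.2

lemma isDeriv_primitive [CompleteSpace E] (f : C(unitInterval, E)) : IsDeriv (primitive f) f := by
  refine .of_hasDerivAt (fun x => ∫ t in (0 : ℝ)..x, IccExtend zero_le_one f t) (fun _ => rfl)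
    fun x => ?_
  rw [← IccExtend_val zero_le_one f x]
  exact (f.continuous.Icc_extend'.integral_hasStrictDerivAt 0 x).hasDerivAt

/-- Variation of constants: `x ↦ ∫₀ˣ (s(x) c(t) - c(x) s(t)) f(t) dt` solves `u'' = -z u + f` if
`c, s` is a fundamental system for `z`. -/
def duhamel (c s : C(unitInterval, ℂ)) : C(unitInterval, E) →L[ℂ] C(unitInterval, E) :=
  mulOperator s ∘L primitive ∘L mulOperator c - mulOperator c ∘L primitive ∘L mulOperator s

/-- The derivative of `duhamel c s f`, as an operator applied to `f`. -/
def duhamelDeriv (z : ℂ) (c s : C(unitInterval, ℂ)) : C(unitInterval, E) →L[ℂ] C(unitInterval, E) :=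
  mulOperator c ∘L primitive ∘L mulOperator c + z • (mulOperator s ∘L primitive ∘L mulOperator s)

namespace IsFundamental

variable [CompleteSpace E] {z : ℂ} {c s : C(unitInterval, ℂ)} (h : IsFundamental z c s)
  (f : C(unitInterval, E))
include h

lemma isDeriv_duhamel : IsDeriv (duhamel c s f) (duhamelDeriv z c s f) := by
  convert! (h.deriv_sin.smul (isDeriv_primitive (c • f))).sub
    (h.deriv_cos.smul (isDeriv_primitive (s • f))) using 1
  change c • primitive (c • f) + z • (s • primitive (s • f)) = _
  ext x
  simp only [ContinuousMap.add_apply, ContinuousMap.sub_apply, ContinuousMap.neg_apply,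
    ContinuousMap.coe_smul, ContinuousMap.coe_smul', Pi.smul_apply, Pi.smul_apply']
  module

lemma isDeriv_duhamelDeriv :
    IsDeriv (duhamelDeriv z c s f) (-(z • duhamel c s f) + f) := by
  convert! (h.deriv_cos.smul (isDeriv_primitive (c • f))).add
    ((h.deriv_sin.smul (isDeriv_primitive (s • f))).const_smul z) using 1
  change -(z • (s • primitive (c • f) - c • primitive (s • f))) + f = _
  ext x
  simp only [ContinuousMap.add_apply, ContinuousMap.sub_apply, ContinuousMap.neg_apply,
    ContinuousMap.coe_smul, ContinuousMap.coe_smul', Pi.smul_apply, Pi.smul_apply']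
  linear_combination (norm := module) -(h.wronskian x • f x)

end IsFundamental

end Duhamel

section BoundaryValueProblem

open Module

lemma finrank_prod_submodule {K X Y : Type*} [DivisionRing K] [AddCommGroup X] [Module K X]
    [AddCommGroup Y] [Module K Y] [FiniteDimensional K X] [FiniteDimensional K Y]
    (W₁ : Submodule K X) (W₂ : Submodule K Y) :
    finrank K (W₁.prod W₂) = finrank K W₁ + finrank K W₂ := by
  rw [← finrank_prod]
  exact LinearEquiv.finrank_eq
    { W₁.toAddSubmonoid.prodEquiv W₂.toAddSubmonoid with map_smul' _ _ := rfl }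

lemma exists_linearMap_sub_mem {K X Y : Type*} [Field K] [AddCommGroup X] [Module K X]
    [AddCommGroup Y] [Module K Y] [FiniteDimensional K X] [FiniteDimensional K Y]
    {B : X →ₗ[K] Y} {W : Submodule K Y} (hB : W.comap B = ⊥)
    (hdim : finrank K X + finrank K W = finrank K Y) :
    ∃ L : Y →ₗ[K] X, ∀ y, B (L y) - y ∈ W := by
  have hinj : Function.Injective (W.mkQ ∘ₗ B) := by
    rw [← LinearMap.ker_eq_bot, LinearMap.ker_comp, Submodule.ker_mkQ, hB]
  have hfin : finrank K X = finrank K (Y ⧸ W) := by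
    have := W.finrank_quotient_add_finrank
    lia
  let T := LinearEquiv.ofInjectiveOfFinrankEq (W.mkQ ∘ₗ B) hinj hfin
  exact ⟨T.symm.toLinearMap ∘ₗ W.mkQ, fun y => (Submodule.Quotient.eq W).1 (T.apply_symm_apply _)⟩

variable {E : Type*} [NormedAddCommGroup E] [NormedSpace ℂ E]

/-- The boundary values `(u(0), u(1))`. -/
def trace : C(unitInterval, E) →L[ℂ] E × E :=
  (ContinuousMap.evalCLM ℂ 0).prod (ContinuousMap.evalCLM ℂ 1)

/-- The boundary values `(-u(0), u(1))`; for `u = v'` they are the outer normal derivatives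
of `v`. -/
def signedTrace : C(unitInterval, E) →L[ℂ] E × E :=
  (-ContinuousMap.evalCLM ℂ 0).prod (ContinuousMap.evalCLM ℂ 1)

/-- The boundary values and outer normal derivatives of `c a + s b`, for coefficients `(a, b)`. -/
def boundaryValues (z : ℂ) (c s : C(unitInterval, ℂ)) : E × E →ₗ[ℂ] (E × E) × (E × E) :=
  (trace.toLinearMap ∘ₗ combination c s).prod
    (signedTrace.toLinearMap ∘ₗ combination (-(z • s)) c)

/-- The Cauchy data `(u(0), u'(0))` of the solutions `u` of `u'' = -z u` with boundary values in
`W₁` and outer normal derivatives in `W₂`, where `c, s` is a fundamental system for `z`. -/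
def cauchySpace (z : ℂ) (c s : C(unitInterval, ℂ)) (W₁ W₂ : Submodule ℂ (E × E)) :
    Submodule ℂ (E × E) :=
  (W₁.prod W₂).comap (boundaryValues z c s)

variable {z : ℂ} {c s : C(unitInterval, ℂ)} {W₁ W₂ : Submodule ℂ (E × E)}

lemma mem_cauchySpace (h : IsFundamental z c s) {a b : E} :
    (a, b) ∈ cauchySpace z c s W₁ W₂ ↔
      (a, c 1 • a + s 1 • b) ∈ W₁ ∧ (-b, -(z * s 1) • a + c 1 • b) ∈ W₂ := by
  have htrace : trace (combination c s (a, b)) = (a, c 1 • a + s 1 • b) := by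
    refine Prod.ext ?_ rfl
    change c 0 • a + s 0 • b = a
    rw [h.cos_zero, h.sin_zero, one_smul, zero_smul, add_zero]
  have hsigned : signedTrace (combination (-(z • s)) c (a, b)) =
      (-b, -(z * s 1) • a + c 1 • b) := by
    refine Prod.ext ?_ rfl
    change -(-(z * s 0) • a + c 0 • b) = -b
    rw [h.cos_zero, h.sin_zero, mul_zero, neg_zero, zero_smul, zero_add, one_smul]
  rw [← htrace, ← hsigned]
  rfl

lemma finrank_cauchySpace_le_swap [FiniteDimensional ℂ E] (h : IsFundamental z c s) (hz : z ≠ 0)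
    {T : E →ₗ[ℂ] E} (hT : Function.Injective T)
    (h₁ : ∀ a b, (a, b) ∈ W₁ → (-T a, T b) ∈ W₁) (h₂ : ∀ a b, (a, b) ∈ W₂ → (-T a, T b) ∈ W₂) :
    finrank ℂ (cauchySpace z c s W₁ W₂) ≤ finrank ℂ (cauchySpace z c s W₂ W₁) := by
  -- On solutions, `Φ` is `u ↦ T u'`, since `u''(0) = -z u(0)`.
  let Φ : E × E →ₗ[ℂ] E × E :=
    (T ∘ₗ LinearMap.snd ℂ E E).prod (-z • T ∘ₗ LinearMap.fst ℂ E E)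
  have hΦ : Function.Injective Φ := by
    refine (injective_iff_map_eq_zero Φ).2 fun p hp => Prod.ext ?_ ?_
    · have hfst : -z • T p.1 = 0 := congrArg Prod.snd hp
      exact (map_eq_zero_iff T hT).1 ((smul_eq_zero_iff_right (neg_ne_zero.2 hz)).1 hfst)
    · exact (map_eq_zero_iff T hT).1 (congrArg Prod.fst hp)
  have hmaps : (cauchySpace z c s W₁ W₂).map Φ ≤ cauchySpace z c s W₂ W₁ := by
    rintro _ ⟨⟨a, b⟩, hab, rfl⟩
    obtain ⟨hval, hder⟩ := (mem_cauchySpace h).1 hab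
    refine (mem_cauchySpace h).2 ⟨?_, ?_⟩
    · convert! h₂ _ _ hder using 2 <;> simp
      module
    · convert! W₁.smul_mem (-z) (h₁ _ _ hval) using 1
      ext <;> simp
      module
  rw [(Submodule.equivMapOfInjective Φ hΦ _).finrank_eq]
  exact Submodule.finrank_mono hmaps

variable [NormedSpace ℝ E]

/-- `A` is the operator `u ↦ -u''` on the functions with boundary values in `W₁` and outer normal
derivatives in `W₂`. -/
def IsNegLaplacian (A : C(unitInterval, E) →ₗ.[ℂ] C(unitInterval, E))
    (W₁ W₂ : Submodule ℂ (E × E)) : Prop :=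
  ∀ u w, (∃ h : u ∈ A.domain, A ⟨u, h⟩ = w) ↔
    ∃ u', IsDeriv u u' ∧ IsDeriv u' (-w) ∧ trace u ∈ W₁ ∧ signedTrace u' ∈ W₂

variable {A : C(unitInterval, E) →ₗ.[ℂ] C(unitInterval, E)} [IsScalarTower ℝ ℂ E]

lemma IsNegLaplacian.eigenspace_eq (hA : IsNegLaplacian A W₁ W₂) (h : IsFundamental z c s) :
    UnboundedOp.eigenspace A z = (cauchySpace z c s W₁ W₂).map (combination c s) := by
  ext u
  rw [UnboundedOp.mem_eigenspace, hA, Submodule.mem_map]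
  constructor
  · rintro ⟨u', hu, hu', h₁, h₂⟩
    have heq := h.eq_combination hu hu'
    rw [heq] at hu h₁
    rw [hu.unique (h.isDeriv_combination _)] at h₂
    exact ⟨_, ⟨h₁, h₂⟩, heq.symm⟩
  · rintro ⟨p, ⟨h₁, h₂⟩, rfl⟩
    exact ⟨_, h.isDeriv_combination p, h.isDeriv_combination_deriv p, h₁, h₂⟩

lemma IsNegLaplacian.finrank_eigenspace (hA : IsNegLaplacian A W₁ W₂) (h : IsFundamental z c s) :
    finrank ℂ (UnboundedOp.eigenspace A z) = finrank ℂ (cauchySpace z c s W₁ W₂) := by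
  rw [hA.eigenspace_eq h]
  exact (Submodule.equivMapOfInjective _ h.combination_injective _).finrank_eq.symm

variable [FiniteDimensional ℂ E]

lemma IsNegLaplacian.exists_right_inverse (hA : IsNegLaplacian A W₁ W₂)
    (hdim : finrank ℂ W₁ + finrank ℂ W₂ = finrank ℂ (E × E))
    (hz : UnboundedOp.eigenspace A z = ⊥) :
    ∃ R : C(unitInterval, E) →L[ℂ] C(unitInterval, E),
      ∀ f, ∃ h : R f ∈ A.domain, A ⟨R f, h⟩ = z • R f + f := by
  have := FiniteDimensional.complete ℂ E
  obtain ⟨c, s, h⟩ := exists_isFundamental z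
  have hbot : cauchySpace z c s W₁ W₂ = ⊥ := by
    rwa [hA.eigenspace_eq h, (Submodule.map_injective_of_injective h.combination_injective).eq_iff'
      (Submodule.map_bot _)] at hz
  obtain ⟨L, hL⟩ := exists_linearMap_sub_mem hbot (by
    rw [finrank_prod_submodule, hdim, finrank_prod (M := E × E)])
  refine ⟨(combination c s ∘ₗ L).toContinuousLinearMap ∘L
    ((trace ∘L duhamel c s).prod (signedTrace ∘L duhamelDeriv z c s)) - duhamel c s, fun f => ?_⟩
  let p := L (trace (duhamel c s f), signedTrace (duhamelDeriv z c s f))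
  obtain ⟨h₁, h₂⟩ := hL (trace (duhamel c s f), signedTrace (duhamelDeriv z c s f))
  refine (hA _ _).2 ⟨combination (-(z • s)) c p - duhamelDeriv z c s f,
    (h.isDeriv_combination p).sub (h.isDeriv_duhamel f), ?_, ?_, ?_⟩
  · convert! (h.isDeriv_combination_deriv p).sub (h.isDeriv_duhamelDeriv f) using 1
    change -(z • (combination c s p - duhamel c s f) + f) = _
    module
  · change trace (combination c s p - duhamel c s f) ∈ W₁
    rw [map_sub]
    exact h₁
  · rw [map_sub]
    exact h₂

lemma IsNegLaplacian.mem_resolventSet_iff (hA : IsNegLaplacian A W₁ W₂)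
    (hdim : finrank ℂ W₁ + finrank ℂ W₂ = finrank ℂ (E × E)) :
    z ∈ UnboundedOp.resolventSet A ↔ UnboundedOp.eigenspace A z = ⊥ := by
  refine ⟨UnboundedOp.eigenspace_eq_bot_of_mem_resolventSet, fun hz => ?_⟩
  obtain ⟨R, hR⟩ := hA.exists_right_inverse hdim hz
  refine ⟨R, fun f => ?_, fun u => ?_⟩
  · obtain ⟨hf, hRf⟩ := hR f
    exact ⟨hf, by rw [hRf, add_sub_cancel_left]⟩
  · obtain ⟨hf, hRf⟩ := hR (A u - z • (u : C(unitInterval, E)))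
    have hker : R (A u - z • (u : C(unitInterval, E))) - u ∈ UnboundedOp.eigenspace A z := by
      refine UnboundedOp.mem_eigenspace.2 ⟨A.domain.sub_mem hf u.2, ?_⟩
      refine (A.map_sub ⟨_, hf⟩ u).trans ?_
      rw [hRf]
      module
    rwa [hz, Submodule.mem_bot, sub_eq_zero] at hker

lemma IsNegLaplacian.finiteDimensional_eigenspace (hA : IsNegLaplacian A W₁ W₂) (z : ℂ) :
    FiniteDimensional ℂ (UnboundedOp.eigenspace A z) := by
  obtain ⟨c, s, h⟩ := exists_isFundamental z
  rw [hA.eigenspace_eq h]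
  infer_instance

lemma IsNegLaplacian.sameSpectrum_iff {B : C(unitInterval, E) →ₗ.[ℂ] C(unitInterval, E)}
    {U₁ U₂ : Submodule ℂ (E × E)} (hA : IsNegLaplacian A W₁ W₂) (hB : IsNegLaplacian B U₁ U₂)
    (hW : finrank ℂ W₁ + finrank ℂ W₂ = finrank ℂ (E × E))
    (hU : finrank ℂ U₁ + finrank ℂ U₂ = finrank ℂ (E × E)) :
    UnboundedOp.SameSpectrum A B ↔ ∀ z, finrank ℂ (UnboundedOp.eigenspace A z) =
      finrank ℂ (UnboundedOp.eigenspace B z) := by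
  have := hA.finiteDimensional_eigenspace
  have := hB.finiteDimensional_eigenspace
  have hrank (z : ℂ) : Module.rank ℂ (UnboundedOp.eigenspace A z) =
      Module.rank ℂ (UnboundedOp.eigenspace B z) ↔ finrank ℂ (UnboundedOp.eigenspace A z) =
        finrank ℂ (UnboundedOp.eigenspace B z) := by
    rw [← finrank_eq_rank, ← finrank_eq_rank, Nat.cast_inj]
  simp only [UnboundedOp.SameSpectrum, hrank, and_iff_right_iff_imp]
  intro hfin
  refine congrArg compl (Set.ext fun z => ?_)
  rw [hA.mem_resolventSet_iff hW, hB.mem_resolventSet_iff hU, ← Submodule.finrank_eq_zero,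
    ← Submodule.finrank_eq_zero, hfin]

end BoundaryValueProblem

section Network

open Module Set

variable {V : Type*} {G : SimpleGraph V}

lemma comp_apply_coe (u : NetFun G) (e : G.edgeSet) (x : unitInterval) : comp u e x = u x e :=
  congrFun (IccExtend_val zero_le_one u x) e

section Incidence

variable (P : EdgeParam G)

lemma forall_incident_eq_iff (φ : V → G.edgeSet → ℂ) :
    (∀ (v : V) (e e' : G.edgeSet), v ∈ (e : Sym2 V) → v ∈ (e' : Sym2 V) → φ v e = φ v e') ↔
      Sum.elim (fun e => φ (P.tail e) e) (fun e => φ (P.head e) e) ∈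
        fiberConstant ℂ P.vertex := by
  rw [mem_fiberConstant_iff_factorsThrough]
  set y := Sum.elim (fun e => φ (P.tail e) e) (fun e => φ (P.head e) e)
  constructor
  · intro h i j hij
    have hedge (i) : ∃ e : G.edgeSet, P.vertex i ∈ (e : Sym2 V) ∧ y i = φ (P.vertex i) e := by
      rcases i with e | e
      · exact ⟨e, P.mem_iff.2 (.inl rfl), rfl⟩
      · exact ⟨e, P.mem_iff.2 (.inr rfl), rfl⟩
    obtain ⟨e, he, hye⟩ := hedge i
    obtain ⟨e', he', hye'⟩ := hedge j
    rw [hye, hye', hij]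
    exact h _ _ _ (hij ▸ he) he'
  · intro h v e e' he he'
    have hend (e : G.edgeSet) (he : v ∈ (e : Sym2 V)) : ∃ i, P.vertex i = v ∧ y i = φ v e := by
      rcases P.mem_iff.1 he with rfl | rfl
      · exact ⟨.inl e, rfl, rfl⟩
      · exact ⟨.inr e, rfl, rfl⟩
    obtain ⟨i, hi, hyi⟩ := hend e he
    obtain ⟨j, hj, hyj⟩ := hend e' he'
    rw [← hyi, ← hyj]
    exact h (hi.trans hj.symm)

/-- The pairs of values at the tails and at the heads of the edges that only depend on the
vertex. -/
def continuousData : Submodule ℂ ((G.edgeSet → ℂ) × (G.edgeSet → ℂ)) :=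
  (fiberConstant ℂ P.vertex).comap
    (LinearEquiv.sumArrowLequivProdArrow G.edgeSet G.edgeSet ℂ ℂ).symm.toLinearMap

lemma mem_continuousData {a b : G.edgeSet → ℂ} :
    (a, b) ∈ continuousData P ↔ ∃ f : V → ℂ, f ∘ P.tail = a ∧ f ∘ P.head = b := by
  change Sum.elim a b ∈ fiberConstant ℂ P.vertex ↔ _
  simp only [mem_fiberConstant, EdgeParam.vertex, Sum.comp_elim, Sum.elim_eq_iff]

variable [DecidableEq V]

lemma pos_tail (e : G.edgeSet) : pos P (P.tail e) e = 0 := if_neg (P.tail_ne_head e)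

lemma pos_head (e : G.edgeSet) : pos P (P.head e) e = 1 := if_pos rfl

lemma incidence_tail (e : G.edgeSet) : incidence P (P.tail e) e = -1 := by
  rw [incidence, if_neg (P.tail_ne_head e), if_pos rfl]

lemma incidence_head (e : G.edgeSet) : incidence P (P.head e) e = 1 := if_pos rfl

end Incidence

variable [Fintype G.edgeSet] {u u' u'' : NetFun G}

lemma IsDeriv.hasDerivWithinAt_comp (hu : IsDeriv u u') (e : G.edgeSet) (x : unitInterval) :
    HasDerivWithinAt (comp u e) (u' x e) (Icc 0 1) x :=
  hasDerivWithinAt_pi.1 (hu x) e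

lemma IsDeriv.edgeDeriv_eq (hu : IsDeriv u u') (e : G.edgeSet) (x : unitInterval) :
    edgeDeriv u e x = u' x e :=
  (hu.hasDerivWithinAt_comp e x).derivWithin (uniqueDiffOn_Icc zero_lt_one x x.2)

lemma IsDeriv.hasDerivWithinAt_edgeDeriv (hu : IsDeriv u u') (hu' : IsDeriv u' u'')
    (e : G.edgeSet) (x : unitInterval) :
    HasDerivWithinAt (edgeDeriv u e) (u'' x e) (Icc 0 1) x :=
  (hu'.hasDerivWithinAt_comp e x).congr_of_mem
    (fun y hy => (hu.edgeDeriv_eq e ⟨y, hy⟩).trans (comp_apply_coe u' e ⟨y, hy⟩).symm) x.2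

lemma IsDeriv.edgeDeriv₂_eq (hu : IsDeriv u u') (hu' : IsDeriv u' u'') (e : G.edgeSet)
    (x : unitInterval) : edgeDeriv₂ u e x = u'' x e :=
  (hu.hasDerivWithinAt_edgeDeriv hu' e x).derivWithin (uniqueDiffOn_Icc zero_lt_one x x.2)

lemma IsC2.exists_isDeriv (hu : IsC2 u) : ∃ u' u'', IsDeriv u u' ∧ IsDeriv u' u'' := by
  let u' : NetFun G := ⟨fun x e => edgeDeriv u e x, continuous_pi fun e =>
    continuousOn_iff_continuous_domRestrict.1 (hu.contDiffOn_deriv e).continuousOn⟩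
  let u'' : NetFun G := ⟨fun x e => edgeDeriv₂ u e x, continuous_pi fun e =>
    continuousOn_iff_continuous_domRestrict.1 (hu.continuousOn_deriv₂ e)⟩
  refine ⟨u', u'', fun x => hasDerivWithinAt_pi.2 fun e => hu.hasDeriv e x.2,
    fun x => hasDerivWithinAt_pi.2 fun e => ?_⟩
  exact (hu.hasDeriv₂ e x.2).congr_of_mem (fun y hy => comp_apply_coe u' e ⟨y, hy⟩) x.2

lemma IsDeriv.isC2 (hu : IsDeriv u u') (hu' : IsDeriv u' u'') : IsC2 u := by
  intro e
  have hud := uniqueDiffOn_Icc (zero_lt_one (α := ℝ))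
  have hderiv₂ : ContinuousOn (derivWithin (edgeDeriv u e) (Icc 0 1)) (Icc 0 1) := by
    refine ContinuousOn.congr (f := comp u'' e) ?_ fun x hx => ?_
    · exact ((continuous_apply e).comp u''.continuous.Icc_extend').continuousOn
    · exact (hu.edgeDeriv₂_eq hu' e ⟨x, hx⟩).trans (comp_apply_coe u'' e ⟨x, hx⟩).symm
  have hderiv : ContDiffOn ℝ (0 + 1) (edgeDeriv u e) (Icc 0 1) :=
    (contDiffOn_succ_iff_derivWithin hud).2 ⟨fun x hx =>
      (hu.hasDerivWithinAt_edgeDeriv hu' e ⟨x, hx⟩).differentiableWithinAt, by simp,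
      contDiffOn_zero.2 hderiv₂⟩
  rw [zero_add] at hderiv
  rw [← one_add_one_eq_two]
  exact (contDiffOn_succ_iff_derivWithin hud).2 ⟨fun x hx =>
    (hu.hasDerivWithinAt_comp e ⟨x, hx⟩).differentiableWithinAt, by simp, hderiv⟩

lemma isNegLaplacian_neg_domRestrict {D : Submodule ℂ (NetFun G)}
    {W₁ W₂ : Submodule ℂ ((G.edgeSet → ℂ) × (G.edgeSet → ℂ))} (hD : ∀ u ∈ D, IsC2 u)
    (hbc : ∀ u u', IsC2 u → IsDeriv u u' → (u ∈ D ↔ trace u ∈ W₁ ∧ signedTrace u' ∈ W₂)) :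
    IsNegLaplacian (-(laplacian G).domRestrict D) W₁ W₂ := by
  intro u w
  have happly {u' u'' : NetFun G} (h : u ∈ (-(laplacian G).domRestrict D).domain)
      (hu : IsDeriv u u') (hu' : IsDeriv u' u'') :
      (-(laplacian G).domRestrict D) ⟨u, h⟩ = -u'' := by
    rw [LinearPMap.neg_apply, neg_inj]
    ext x e
    exact hu.edgeDeriv₂_eq hu' e x
  constructor
  · rintro ⟨h, rfl⟩
    have hC2 := hD u h.1
    obtain ⟨u', u'', hu, hu'⟩ := hC2.exists_isDeriv
    exact ⟨u', hu, by rwa [happly h hu hu', neg_neg], (hbc u u' hC2 hu).1 h.1⟩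
  · rintro ⟨u', hu, hu', hW⟩
    have hC2 := hu.isC2 hu'
    exact ⟨⟨(hbc u u' hC2 hu).2 hW, hC2⟩, (happly _ hu hu').trans (neg_neg w)⟩

section BoundaryConditions

variable (P : EdgeParam G)

/-- The pairs of values at the tails and at the heads of the edges that sum up to zero at every
vertex. -/
def balancedData : Submodule ℂ ((G.edgeSet → ℂ) × (G.edgeSet → ℂ)) :=
  (fiberBalanced ℂ P.vertex).comap
    (LinearEquiv.sumArrowLequivProdArrow G.edgeSet G.edgeSet ℂ ℂ).symm.toLinearMap

lemma mem_balancedData {a b : G.edgeSet → ℂ} :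
    (a, b) ∈ balancedData P ↔ ∀ f : V → ℂ, (f ∘ P.tail) ⬝ᵥ a + (f ∘ P.head) ⬝ᵥ b = 0 := by
  change Sum.elim a b ∈ fiberBalanced ℂ P.vertex ↔ _
  simp only [mem_fiberBalanced, EdgeParam.vertex, Sum.comp_elim, sumElim_dotProduct_sumElim]

lemma finrank_continuousData_add_finrank_balancedData :
    finrank ℂ (continuousData P) + finrank ℂ (balancedData P) =
      finrank ℂ ((G.edgeSet → ℂ) × (G.edgeSet → ℂ)) := by
  rw [continuousData, balancedData, ← Submodule.map_equiv_eq_comap_symm,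
    ← Submodule.map_equiv_eq_comap_symm, LinearEquiv.finrank_map_eq, LinearEquiv.finrank_map_eq,
    add_comm, fiberBalanced, finrank_dotOrthogonal_add_finrank, ← finrank_fintype_fun_eq_card ℂ]
  exact (LinearEquiv.sumArrowLequivProdArrow G.edgeSet G.edgeSet ℂ ℂ).finrank_eq

variable [DecidableEq V]

lemma IsDeriv.ckCondition_iff (hu : IsDeriv u u') :
    CKCondition P u ↔ trace u ∈ continuousData P ∧ signedTrace u' ∈ balancedData P := by
  have hvalues : Sum.elim (fun e => u (pos P (P.tail e) e) e) (fun e => u (pos P (P.head e) e) e) =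
      Sum.elim (u 0) (u 1) := by
    simp only [pos_tail, pos_head]
  refine and_congr ?_ ?_
  · rw [forall_incident_eq_iff P fun v e => u (pos P v e) e, hvalues]
    rfl
  · change _ ↔ Sum.elim (-u' 0) (u' 1) ∈ fiberBalanced ℂ P.vertex
    rw [mem_fiberBalanced_iff_sum_fiber]
    refine forall_congr' fun v => Eq.congr_left ?_
    rw [P.sum_fiber_vertex]
    refine Finset.sum_congr rfl fun e _ => ?_
    rw [hu.edgeDeriv_eq, incidence, pos]
    split_ifs <;> simp

lemma IsDeriv.kcCondition_iff (hu : IsDeriv u u') :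
    KCCondition P u ↔ trace u ∈ balancedData P ∧ signedTrace u' ∈ continuousData P := by
  have hderivs : Sum.elim
      (fun e => incidence P (P.tail e) e * edgeDeriv u e (pos P (P.tail e) e))
      (fun e => incidence P (P.head e) e * edgeDeriv u e (pos P (P.head e) e)) =
        Sum.elim (-u' 0) (u' 1) := by
    simp only [hu.edgeDeriv_eq, pos_tail, pos_head, incidence_tail, incidence_head, neg_one_mul,
      one_mul]
    rfl
  refine and_congr ?_ ?_
  · change _ ↔ Sum.elim (u 0) (u 1) ∈ fiberBalanced ℂ P.vertex
    rw [mem_fiberBalanced_iff_sum_fiber]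
    refine forall_congr' fun v => Eq.congr_left ?_
    rw [P.sum_fiber_vertex]
    refine Finset.sum_congr rfl fun e _ => ?_
    rw [incidence, pos]
    split_ifs <;> simp
  · rw [forall_incident_eq_iff P fun v e => incidence P v e * edgeDeriv u e (pos P v e), hderivs]
    rfl

lemma isNegLaplacian_neg_laplacianCK :
    IsNegLaplacian (-laplacianCK P) (continuousData P) (balancedData P) :=
  isNegLaplacian_neg_domRestrict (fun _ hu => hu.1) fun _ _ hC2 hu =>
    (and_iff_right hC2).trans (hu.ckCondition_iff P)

lemma isNegLaplacian_neg_laplacianKC :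
    IsNegLaplacian (-laplacianKC P) (balancedData P) (continuousData P) :=
  isNegLaplacian_neg_domRestrict (fun _ hu => hu.1) fun _ _ hC2 hu =>
    (and_iff_right hC2).trans (hu.kcCondition_iff P)

end BoundaryConditions

end Network

section EvenOdd

open Module

section Ring

variable {R X : Type*} [Ring R] [AddCommGroup X] [Module R X]

/-- The vectors `a` with `(a, a) ∈ W`: the constant functions with boundary values in `W`. -/
def evenPart (W : Submodule R (X × X)) : Submodule R X := W.comap (.prod .id .id)

/-- The vectors `a` with `(a, -a) ∈ W`: the multiples of `cos (π x)` with boundary values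
in `W`. -/
def oddPart (W : Submodule R (X × X)) : Submodule R X := W.comap (.prod .id (-.id))

lemma mem_evenPart {W : Submodule R (X × X)} {a : X} : a ∈ evenPart W ↔ (a, a) ∈ W := .rfl

lemma mem_oddPart {W : Submodule R (X × X)} {a : X} : a ∈ oddPart W ↔ (a, -a) ∈ W := .rfl

end Ring

variable {E : Type*} [NormedAddCommGroup E] [NormedSpace ℂ E] {W₁ W₂ : Submodule ℂ (E × E)}

lemma cauchySpace_pi_sq_eq_prod :
    cauchySpace ((Real.pi : ℂ) ^ 2) (cosFun Real.pi) (sincFun Real.pi) W₁ W₂ =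
      (oddPart W₁).prod (evenPart W₂) := by
  have hπ : (Real.pi : ℂ) ≠ 0 := Complex.ofReal_ne_zero.2 Real.pi_ne_zero
  have hcos : cosFun Real.pi 1 = -1 := by simp [cosFun]
  have hsinc : sincFun Real.pi 1 = 0 := by simp [sincFun]
  ext ⟨a, b⟩
  rw [mem_cauchySpace (isFundamental_cos_sinc hπ), hcos, hsinc, Submodule.mem_prod, mem_oddPart,
    mem_evenPart]
  refine and_congr (by simp) ?_
  simpa using W₂.neg_mem_iff (x := (b, b))

variable [NormedSpace ℝ E] [IsScalarTower ℝ ℂ E] [FiniteDimensional ℂ E]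
  {A : C(unitInterval, E) →ₗ.[ℂ] C(unitInterval, E)}

lemma IsNegLaplacian.finrank_eigenspace_pi_sq (hA : IsNegLaplacian A W₁ W₂) :
    finrank ℂ (UnboundedOp.eigenspace A ((Real.pi : ℂ) ^ 2)) =
      finrank ℂ (oddPart W₁) + finrank ℂ (evenPart W₂) := by
  have hπ : (Real.pi : ℂ) ≠ 0 := Complex.ofReal_ne_zero.2 Real.pi_ne_zero
  rw [hA.finrank_eigenspace (isFundamental_cos_sinc hπ), cauchySpace_pi_sq_eq_prod,
    finrank_prod_submodule]

end EvenOdd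

section Multiplicities

open Module UnboundedOp

open scoped ComplexOrder in
-- `hW` kills the boundary term in Green's formula, so `∫ |u'|² = 0` when `u'' = 0`.
lemma cauchySpace_zero_eq_prod {ι : Type*} [Fintype ι] {W₁ W₂ : Submodule ℂ ((ι → ℂ) × (ι → ℂ))}
    (hW : ∀ p ∈ W₁, ∀ q ∈ W₂, star p.1 ⬝ᵥ q.1 + star p.2 ⬝ᵥ q.2 = 0) :
    cauchySpace 0 1 idFun W₁ W₂ = (evenPart W₁).prod ⊥ := by
  have hid : idFun 1 = 1 := by simp [idFun]
  ext ⟨a, b⟩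
  rw [mem_cauchySpace isFundamental_zero, hid, Submodule.mem_prod, mem_evenPart, Submodule.mem_bot]
  simp only [ContinuousMap.one_apply, one_smul, zero_mul, neg_zero, zero_smul, zero_add]
  constructor
  · rintro ⟨hval, hder⟩
    obtain rfl : b = 0 := by simpa using hW _ hval _ hder
    exact ⟨by simpa using hval, rfl⟩
  · rintro ⟨ha, rfl⟩
    exact ⟨by simpa using ha, by simp [← Prod.zero_eq_mk]⟩

lemma IsNegLaplacian.finrank_eigenspace_zero {ι : Type*} [Fintype ι]
    {W₁ W₂ : Submodule ℂ ((ι → ℂ) × (ι → ℂ))}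
    {A : C(unitInterval, ι → ℂ) →ₗ.[ℂ] C(unitInterval, ι → ℂ)} (hA : IsNegLaplacian A W₁ W₂)
    (hW : ∀ p ∈ W₁, ∀ q ∈ W₂, star p.1 ⬝ᵥ q.1 + star p.2 ⬝ᵥ q.2 = 0) :
    finrank ℂ (eigenspace A 0) = finrank ℂ (evenPart W₁) := by
  rw [hA.finrank_eigenspace isFundamental_zero, cauchySpace_zero_eq_prod hW,
    finrank_prod_submodule, finrank_bot, add_zero]

variable {V : Type*} {G : SimpleGraph V} (P : EdgeParam G)

lemma evenPart_continuousData [Finite G.edgeSet] (hG : G.Connected) :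
    evenPart (continuousData P) = Submodule.span ℂ {1} := by
  ext a
  rw [mem_evenPart, mem_continuousData, Submodule.mem_span_singleton]
  constructor
  · rintro ⟨f, hf, hf'⟩
    obtain ⟨v₀⟩ := hG.nonempty
    have hconst (v : V) : f v₀ = f v :=
      eq_of_connected_of_forall_adj hG (P.forall_adj_of_forall_edge (fun _ _ => Eq.symm)
        (congrFun (hf.trans hf'.symm))) v₀ v
    refine ⟨f v₀, hf ▸ funext fun e => ?_⟩
    simp [hconst (P.tail e)]
  · rintro ⟨t, rfl⟩
    exact ⟨fun _ => t, funext fun _ => (mul_one t).symm, funext fun _ => (mul_one t).symm⟩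

lemma oddPart_continuousData_eq_bot (hG : G.Connected) (hb : ¬ G.IsBipartite) :
    oddPart (continuousData P) = ⊥ := by
  refine (Submodule.eq_bot_iff _).2 fun a ha => ?_
  obtain ⟨f, rfl, hf⟩ := (mem_continuousData P).1 ha
  have hker : f ∈ LinearMap.ker (P.coboundary 1) :=
    P.mem_ker_coboundary.2 fun e => by simpa using congrFun hf e
  rw [P.ker_coboundary_one_eq_bot_of_not_isBipartite two_ne_zero hG hb, Submodule.mem_bot] at hker
  rw [hker]
  rfl

lemma mul_mem_continuousData (f : V → ℂ) {a b : G.edgeSet → ℂ} (h : (a, b) ∈ continuousData P) :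
    (f ∘ P.tail * a, f ∘ P.head * b) ∈ continuousData P := by
  obtain ⟨g, rfl, rfl⟩ := (mem_continuousData P).1 h
  exact (mem_continuousData P).2 ⟨f * g, rfl, rfl⟩

variable [Fintype G.edgeSet]

lemma mul_mem_balancedData (f : V → ℂ) {a b : G.edgeSet → ℂ} (h : (a, b) ∈ balancedData P) :
    (f ∘ P.tail * a, f ∘ P.head * b) ∈ balancedData P := by
  refine (mem_balancedData P).2 fun g => ?_
  convert! (mem_balancedData P).1 h (g * f) using 2 <;>
    simp only [dotProduct, Pi.mul_apply, Function.comp_apply, mul_assoc]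

lemma evenPart_balancedData : evenPart (balancedData P) = P.cycleSpace 1 := by
  ext a
  rw [P.mem_cycleSpace, one_smul]
  rfl

lemma oddPart_balancedData : oddPart (balancedData P) = P.cycleSpace (-1) := by
  ext a
  rw [P.mem_cycleSpace, mem_oddPart, ← Submodule.neg_mem_iff, neg_one_smul, Prod.neg_mk, neg_neg]
  rfl

lemma star_dotProduct_add_star_dotProduct_eq_zero :
    ∀ p ∈ continuousData P, ∀ q ∈ balancedData P, star p.1 ⬝ᵥ q.1 + star p.2 ⬝ᵥ q.2 = 0 := by
  rintro ⟨a, b⟩ h q h'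
  obtain ⟨f, rfl, rfl⟩ := (mem_continuousData P).1 h
  exact (mem_balancedData P).1 h' (star f)

variable [DecidableEq V]

lemma finrank_eigenspace_laplacianCK_zero [Nonempty G.edgeSet] (hG : G.Connected) :
    finrank ℂ (eigenspace (-laplacianCK P) 0) = 1 := by
  rw [(isNegLaplacian_neg_laplacianCK P).finrank_eigenspace_zero
    (star_dotProduct_add_star_dotProduct_eq_zero P), evenPart_continuousData P hG,
    finrank_span_singleton one_ne_zero]

lemma finrank_eigenspace_laplacianKC_zero :
    finrank ℂ (eigenspace (-laplacianKC P) 0) = finrank ℂ (P.cycleSpace (1 : ℂ)) := by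
  rw [(isNegLaplacian_neg_laplacianKC P).finrank_eigenspace_zero, evenPart_balancedData]
  intro p hp q hq
  simpa [dotProduct, mul_comm] using
    congrArg star (star_dotProduct_add_star_dotProduct_eq_zero P q hq p hp)

lemma finrank_eigenspace_laplacianCK_pi_sq (hG : G.Connected) (hb : ¬ G.IsBipartite) :
    finrank ℂ (eigenspace (-laplacianCK P) ((Real.pi : ℂ) ^ 2)) =
      finrank ℂ (P.cycleSpace (1 : ℂ)) := by
  rw [(isNegLaplacian_neg_laplacianCK P).finrank_eigenspace_pi_sq,
    oddPart_continuousData_eq_bot P hG hb, finrank_bot, zero_add, evenPart_balancedData]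

lemma finrank_eigenspace_laplacianKC_pi_sq [Nonempty G.edgeSet] (hG : G.Connected) :
    finrank ℂ (eigenspace (-laplacianKC P) ((Real.pi : ℂ) ^ 2)) =
      finrank ℂ (P.cycleSpace (-1 : ℂ)) + 1 := by
  rw [(isNegLaplacian_neg_laplacianKC P).finrank_eigenspace_pi_sq, oddPart_balancedData,
    evenPart_continuousData P hG, finrank_span_singleton one_ne_zero]

lemma finrank_eigenspace_laplacian_eq_of_isBipartite (hb : G.IsBipartite) {z : ℂ} (hz : z ≠ 0) :
    finrank ℂ (eigenspace (-laplacianCK P) z) = finrank ℂ (eigenspace (-laplacianKC P) z) := by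
  obtain ⟨σ, hσ, hadj⟩ := exists_sign_of_isBipartite (R := ℂ) hb
  have hσ0 (v : V) : σ v ≠ 0 := by rcases hσ v with h | h <;> simp [h]
  let T := LinearMap.mulLeft ℂ (σ ∘ P.head)
  have hT : Function.Injective T := fun a b hab =>
    funext fun e => mul_left_cancel₀ (hσ0 (P.head e)) (congrFun hab e)
  have htail (a : G.edgeSet → ℂ) : -T a = σ ∘ P.tail * a :=
    funext fun e => by simp [T, hadj _ _ (P.adj e)]
  have hcont (a b : G.edgeSet → ℂ) (h : (a, b) ∈ continuousData P) :
      (-T a, T b) ∈ continuousData P := htail a ▸ mul_mem_continuousData P σ h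
  have hbal (a b : G.edgeSet → ℂ) (h : (a, b) ∈ balancedData P) :
      (-T a, T b) ∈ balancedData P := htail a ▸ mul_mem_balancedData P σ h
  obtain ⟨c, s, h⟩ := exists_isFundamental z
  rw [(isNegLaplacian_neg_laplacianCK P).finrank_eigenspace h,
    (isNegLaplacian_neg_laplacianKC P).finrank_eigenspace h]
  exact (finrank_cauchySpace_le_swap h hz hT hcont hbal).antisymm
    (finrank_cauchySpace_le_swap h hz hT hbal hcont)

variable [Nonempty G.edgeSet]

lemma isBipartite_of_finrank_eigenspace_pi_sq_eq [Finite V] (hG : G.Connected)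
    (h : finrank ℂ (eigenspace (-laplacianCK P) ((Real.pi : ℂ) ^ 2)) =
      finrank ℂ (eigenspace (-laplacianKC P) ((Real.pi : ℂ) ^ 2))) : G.IsBipartite := by
  have := Fintype.ofFinite V
  by_contra hb
  rw [finrank_eigenspace_laplacianCK_pi_sq P hG hb, finrank_eigenspace_laplacianKC_pi_sq P hG] at h
  have hone := P.finrank_cycleSpace_one_of_not_isBipartite ℂ two_ne_zero hG hb
  have hneg := P.finrank_cycleSpace_neg_one ℂ hG
  omega

lemma finrank_eigenspace_zero_eq_iff_card_eq [Fintype V] (hG : G.Connected) (hb : G.IsBipartite) :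
    finrank ℂ (eigenspace (-laplacianCK P) 0) = finrank ℂ (eigenspace (-laplacianKC P) 0) ↔
      Fintype.card G.edgeSet = Fintype.card V := by
  rw [finrank_eigenspace_laplacianCK_zero P hG, finrank_eigenspace_laplacianKC_zero]
  have hone := P.finrank_cycleSpace_one_of_isBipartite ℂ hG hb
  omega

end Multiplicities

end QGraph
end

theorem corollary4p4 {V : Type*} [Fintype V] [DecidableEq V] [Nontrivial V]
    (G : SimpleGraph V) [DecidableRel G.Adj] (hG : G.Connected) (P : EdgeParam G) :
    UnboundedOp.SameSpectrum (-QGraph.laplacianCK P) (-QGraph.laplacianKC P) ↔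
      (IsUnicyclic G ∧ G.IsBipartite) := by
  have : Nonempty G.edgeSet := by
    obtain ⟨v⟩ := hG.nonempty
    obtain ⟨w, hvw⟩ := hG.preconnected.exists_adj_of_nontrivial v
    exact ⟨⟨s(v, w), hvw⟩⟩
  have hdim := QGraph.finrank_continuousData_add_finrank_balancedData P
  rw [(QGraph.isNegLaplacian_neg_laplacianCK P).sameSpectrum_iff
    (QGraph.isNegLaplacian_neg_laplacianKC P) hdim ((add_comm _ _).trans hdim),
    isUnicyclic_iff_card_eq P hG]
  constructor
  · intro hspec
    have hb := QGraph.isBipartite_of_finrank_eigenspace_pi_sq_eq P hG (hspec _)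
    exact ⟨(QGraph.finrank_eigenspace_zero_eq_iff_card_eq P hG hb).1 (hspec 0), hb⟩
  · rintro ⟨hcard, hb⟩ z
    rcases eq_or_ne z 0 with rfl | hz
    · exact (QGraph.finrank_eigenspace_zero_eq_iff_card_eq P hG hb).2 hcard
    · exact QGraph.finrank_eigenspace_laplacian_eq_of_isBipartite P hb hz
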